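/- Let $D<0$ be an integer with $D\equiv 0$ or $1 \pmod 4$ and let $N\ge 1$ be an integer. Let $\mathrm{QF}(D)$ be the set of primitive positive-definite binary quadratic forms $ax^2+bxy+cy^2$ with integer coefficients and discriminant $b^2-4ac=D$. Let $$\mathcal C(D,\Gamma_0(N))=\{ax^2+bxy+cy^2\in \mathrm{QF}(D) : \gcd(a,N)=1\}/\sim,$$ where $Q\sim Q'$ means that $Q'(x,y)=Q(px+qy,\,rx+sy)$ for some $\begin{pmatrix}p&q\\ r&s\end{pmatrix}\in\mathrm{SL}_2(\mathbb Z)$ with $r\equiv 0\pmod N$. If $Q=ax^2+bxy+cy^2$ and $Q'=a'x^2+b'xy+c'y^2$ in $\mathrm{QF}(D)$ satisfy $\gcd(a,a',\frac{b+b'}2)=1$, their Dirichlet composition is the form $$Q''=aa'x^2+Bxy+\tfrac{B^2-D}{4aa'}y^2,$$ where $B\equiv b\pmod{2a}$, $B\equiv b'\pmod{2a'}$ and $B^2\equiv D\pmod{4aa'}$ (such a $B$ exists and is unique modulo $2aa'$). There is exactly one binary operation on $\mathcal C(D,\Gamma_0(N))$ such that $[Q]\cdot[Q']=[Q'']$ for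 all representatives $Q,Q'$ with $\gcd(a,a')=1$ and every choice of $B$. The same formula then holds for all representatives $Q,Q'$ with $\gcd(a,a',\frac{b+b'}2)=1$ (and $Q''$ is again in $\mathrm{QF}(D)$ with leading coefficient prime to $N$), and $\mathcal C(D,\Gamma_0(N))$ is an abelian group under this operation. In this group, the identity element is $$\left[x^2-\tfrac D4y^2\right]\ \text{ if } D\equiv 0\pmod 4,\qquad \left[x^2+xy+\tfrac{1-D}4y^2\right]\ \text{ if } D\equiv 1\pmod 4,$$ and the inverse of $[ax^2+bxy+cy^2]$ is $[ax^2-bxy+cy^2]$. -/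

import Mathlib

/-- The binary quadratic form `a x² + b x y + c y²` with integer coefficients. -/
@[ext] structure BinForm where
  a : ℤ
  b : ℤ
  c : ℤ

namespace BinForm

/-- The value `Q(x, y)`. -/
def eval (Q : BinForm) (x y : ℤ) : ℤ := Q.a * x ^ 2 + Q.b * x * y + Q.c * y ^ 2

def disc (Q : BinForm) : ℤ := Q.b ^ 2 - 4 * Q.a * Q.c

def IsPrimitive (Q : BinForm) : Prop := Int.gcd (Int.gcd Q.a Q.b : ℤ) Q.c = 1

def IsPosDef (Q : BinForm) : Prop := ∀ x y : ℤ, (x ≠ 0 ∨ y ≠ 0) → 0 < Q.eval x y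

/-- `QF(D)`: the primitive positive-definite forms of discriminant `D`. -/
def QF (D : ℤ) : Set BinForm := {Q | Q.IsPrimitive ∧ Q.IsPosDef ∧ Q.disc = D}

/-- The forms in `QF(D)` whose leading coefficient is relatively prime to `N`. -/
def QFCoprime (D : ℤ) (N : ℕ) : Set BinForm := {Q | Q ∈ QF D ∧ Int.gcd Q.a N = 1}

/-- `Q'` is `Γ`-equivalent to `Q`: `Q'(x, y) = Q(p x + q y, r x + s y)` for some matrix
`(p, q; r, s)` in `Γ`. -/
def GammaEquiv (Γ : Subgroup (Matrix.SpecialLinearGroup (Fin 2) ℤ)) (Q Q' : BinForm) : Prop :=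
  ∃ γ ∈ Γ, ∀ x y : ℤ, Q'.eval x y = Q.eval (γ 0 0 * x + γ 0 1 * y) (γ 1 0 * x + γ 1 1 * y)

theorem GammaEquiv.refl (Γ : Subgroup (Matrix.SpecialLinearGroup (Fin 2) ℤ)) (Q : BinForm) :
    GammaEquiv Γ Q Q :=
  ⟨1, Γ.one_mem, fun x y => by simp⟩

theorem GammaEquiv.symm {Γ : Subgroup (Matrix.SpecialLinearGroup (Fin 2) ℤ)} {Q Q' : BinForm}
    (h : GammaEquiv Γ Q Q') : GammaEquiv Γ Q' Q := by
  obtain ⟨γ, hγ, h⟩ := h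
  refine ⟨γ⁻¹, Γ.inv_mem hγ, fun x y => ?_⟩
  have hdet : γ 0 0 * γ 1 1 - γ 0 1 * γ 1 0 = 1 := by
    rw [← Matrix.det_fin_two]; exact γ.det_coe
  rw [h]
  simp only [Matrix.SpecialLinearGroup.coe_inv, Matrix.adjugate_fin_two, Matrix.of_apply,
    Matrix.cons_val', Matrix.cons_val_zero, Matrix.cons_val_one, Matrix.cons_val_fin_one]
  congr 1
  · linear_combination (-x) * hdet
  · linear_combination (-y) * hdet

theorem GammaEquiv.trans {Γ : Subgroup (Matrix.SpecialLinearGroup (Fin 2) ℤ)}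
    {Q Q' Q'' : BinForm} (h : GammaEquiv Γ Q Q') (h' : GammaEquiv Γ Q' Q'') :
    GammaEquiv Γ Q Q'' := by
  obtain ⟨γ, hγ, h⟩ := h
  obtain ⟨δ, hδ, h'⟩ := h'
  refine ⟨γ * δ, Γ.mul_mem hγ hδ, fun x y => ?_⟩
  rw [h', h]
  simp only [Matrix.SpecialLinearGroup.coe_mul, Matrix.mul_apply, Fin.sum_univ_two]
  congr 1 <;> ring

/-- `Γ₀(N)`-equivalence on the forms in `QF(D)` with leading coefficient prime to `N`. -/
instance gammaSetoid (D : ℤ) (N : ℕ) : Setoid (QFCoprime D N) where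
  r Q Q' := GammaEquiv (CongruenceSubgroup.Gamma0 N) Q.1 Q'.1
  iseqv := ⟨fun Q => GammaEquiv.refl _ Q.1, GammaEquiv.symm, GammaEquiv.trans⟩

/-- The set `C(D, Γ₀(N))` of classes. -/
def FormClass (D : ℤ) (N : ℕ) : Type := Quotient (gammaSetoid D N)

/-- The class `[Q]` in `C(D, Γ₀(N))`. -/
def cls {D : ℤ} {N : ℕ} (Q : BinForm) (hQ : Q ∈ QFCoprime D N) : FormClass D N :=
  Quotient.mk (gammaSetoid D N) ⟨Q, hQ⟩

/-- `Q''` is a Dirichlet composition of the forms `Q`, `Q'` of discriminant `D`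
(a choice of it: the coefficient `B = Q''.b` is only determined modulo `2 a a'`).
For forms of the same discriminant `b + b'` is even. -/
def IsDirichletComposition (D : ℤ) (Q Q' Q'' : BinForm) : Prop :=
  Int.gcd (Int.gcd Q.a Q'.a : ℤ) ((Q.b + Q'.b) / 2) = 1 ∧
  Q''.a = Q.a * Q'.a ∧
  Q''.b ≡ Q.b [ZMOD 2 * Q.a] ∧
  Q''.b ≡ Q'.b [ZMOD 2 * Q'.a] ∧
  Q''.b ^ 2 ≡ D [ZMOD 4 * (Q.a * Q'.a)] ∧
  Q''.c = (Q''.b ^ 2 - D) / (4 * (Q.a * Q'.a))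

/-- The binary operation `op` on classes is given by Dirichlet composition of representatives
with relatively prime leading coefficients. -/
def IsCompositionLaw {D : ℤ} {N : ℕ} (op : FormClass D N → FormClass D N → FormClass D N) :
    Prop :=
  ∀ (Q Q' Q'' : BinForm) (hQ : Q ∈ QFCoprime D N) (hQ' : Q' ∈ QFCoprime D N)
    (hQ'' : Q'' ∈ QFCoprime D N), Int.gcd Q.a Q'.a = 1 → IsDirichletComposition D Q Q' Q'' →
      op (cls Q hQ) (cls Q' hQ') = cls Q'' hQ''

theorem isPosDef_of_disc_neg {Q : BinForm} (ha : 0 < Q.a) (hd : Q.disc < 0) : Q.IsPosDef := by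
  intro x y hxy
  have key : 4 * Q.a * Q.eval x y = (2 * Q.a * x + Q.b * y) ^ 2 + (-Q.disc) * y ^ 2 := by
    simp only [eval, disc]; ring
  have hpos : 0 < 4 * Q.a * Q.eval x y := by
    rw [key]
    by_cases hy : y = 0
    · subst hy
      have hx : x ≠ 0 := by simpa using hxy
      have : 2 * Q.a * x ≠ 0 := mul_ne_zero (by positivity) hx
      have h4 : 0 < (2 * Q.a * x) ^ 2 := by positivity
      simpa using h4
    · have h2 : 0 < y ^ 2 := by positivity
      have h3 : 0 < (-Q.disc) * y ^ 2 := mul_pos (by omega) h2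
      positivity
  exact (mul_pos_iff_of_pos_left (by positivity)).1 hpos

theorem principal_zero_mem {D : ℤ} (N : ℕ) (hD : D < 0) (h : D ≡ 0 [ZMOD 4]) :
    (⟨1, 0, -(D / 4)⟩ : BinForm) ∈ QFCoprime D N := by
  have hd : (⟨1, 0, -(D / 4)⟩ : BinForm).disc = D := by
    simp only [disc]
    have : D % 4 = 0 := h
    omega
  refine ⟨⟨by simp [IsPrimitive], isPosDef_of_disc_neg (by norm_num) (by rw [hd]; exact hD), hd⟩,
    by simp⟩

theorem principal_one_mem {D : ℤ} (N : ℕ) (hD : D < 0) (h : D ≡ 1 [ZMOD 4]) :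
    (⟨1, 1, (1 - D) / 4⟩ : BinForm) ∈ QFCoprime D N := by
  have hd : (⟨1, 1, (1 - D) / 4⟩ : BinForm).disc = D := by
    simp only [disc]
    have : D % 4 = 1 := h
    omega
  refine ⟨⟨by simp [IsPrimitive], isPosDef_of_disc_neg (by norm_num) (by rw [hd]; exact hD), hd⟩,
    by simp⟩

/-- `a x² - b x y + c y²`. -/
def opposite (Q : BinForm) : BinForm := ⟨Q.a, -Q.b, Q.c⟩

theorem opposite_mem {D : ℤ} {N : ℕ} {Q : BinForm} (hQ : Q ∈ QFCoprime D N) :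
    Q.opposite ∈ QFCoprime D N := by
  obtain ⟨⟨hp, hpos, hd⟩, hN⟩ := hQ
  refine ⟨⟨?_, ?_, ?_⟩, hN⟩
  · simpa [IsPrimitive, opposite] using hp
  · intro x y hxy
    have := hpos x (-y) (by simpa using hxy)
    simpa [eval, opposite] using this
  · simpa [disc, opposite] using hd

end BinForm

/-! Replace `Q` by the form `Q(x, N y)` of discriminant `N² D`, and attach to a form the lattice `ℤ
a + ℤ (-b + √disc)/2` in `ℂ`. Conjugation by `diag(1, N)` turns a `Γ₀(N)`-equivalence into a proper
equivalence of scaled forms, and `gcd(a, N) = 1` gives the converse (`dvd_of_scale_eq_subst`).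
Properly equivalent positive definite forms are those with homothetic lattices, so classes embed
into the commutative monoid of `ℤ`-submodules of `ℂ` up to homothety (`gammaEquiv_iff_homothety`,
`latticeClass_injective`).

Dirichlet composition becomes multiplication of lattices (`IsDirichletComposition.latticeClass_eq`),
so it is well defined on classes, associative and commutative. The image is closed under products
because any two classes have representatives with coprime leading coefficients; this also gives
uniqueness of the operation. The principal form acts as identity on the image, and a lattice times
its conjugate is a multiple of the principal one (`homothety_mul_opposite`). -/

namespace BinForm

open Complex

/-! ### Substitutions and scaling by `N` -/

/-- The form `f(p x + q y, r x + s y)`. -/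
def subst (f : BinForm) (p q r s : ℤ) : BinForm :=
  ⟨f.eval p r, 2 * f.a * p * q + f.b * (p * s + q * r) + 2 * f.c * r * s, f.eval q s⟩

theorem eval_subst (f : BinForm) (p q r s x y : ℤ) :
    (f.subst p q r s).eval x y = f.eval (p * x + q * y) (r * x + s * y) := by
  simp only [eval, subst]; ring

theorem ext_eval {f g : BinForm} (h : ∀ x y, f.eval x y = g.eval x y) : f = g := by
  have h1 := h 1 0
  have h2 := h 0 1
  have h3 := h 1 1
  simp only [eval] at h1 h2 h3
  ext <;> linarith

theorem disc_subst (f : BinForm) {p q r s : ℤ} (h : p * s - q * r = 1) :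
    (f.subst p q r s).disc = f.disc := by
  have : (f.subst p q r s).disc = f.disc * (p * s - q * r) ^ 2 := by
    simp only [disc, subst, eval]; ring
  rw [this, h]; ring

theorem gammaEquiv_Gamma0_iff {N : ℕ} {Q Q' : BinForm} :
    GammaEquiv (CongruenceSubgroup.Gamma0 N) Q Q' ↔
      ∃ p q r s : ℤ, p * s - q * (N * r) = 1 ∧ Q' = Q.subst p q (N * r) s := by
  constructor
  · rintro ⟨γ, hγ, h⟩
    rw [CongruenceSubgroup.Gamma0_mem, ZMod.intCast_zmod_eq_zero_iff_dvd] at hγ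
    obtain ⟨r, hr⟩ := hγ
    have hdet : γ 0 0 * γ 1 1 - γ 0 1 * γ 1 0 = 1 := by
      rw [← Matrix.det_fin_two]; exact γ.det_coe
    refine ⟨γ 0 0, γ 0 1, r, γ 1 1, by rw [← hr]; exact hdet, ext_eval fun x y => ?_⟩
    rw [eval_subst, h, hr]
  · rintro ⟨p, q, r, s, hdet, rfl⟩
    let γ : Matrix.SpecialLinearGroup (Fin 2) ℤ :=
      ⟨!![p, q; N * r, s], by rw [Matrix.det_fin_two_of]; exact hdet⟩
    refine ⟨γ, ?_, fun x y => eval_subst Q p q (N * r) s x y⟩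
    rw [CongruenceSubgroup.Gamma0_mem, ZMod.intCast_zmod_eq_zero_iff_dvd]
    exact ⟨r, rfl⟩

/-- The form `Q(x, N y)`. -/
def scale (N : ℤ) (Q : BinForm) : BinForm := ⟨Q.a, N * Q.b, N ^ 2 * Q.c⟩

theorem disc_scale (N : ℤ) (Q : BinForm) : (Q.scale N).disc = N ^ 2 * Q.disc := by
  simp only [disc, scale]; ring

theorem scale_subst (N : ℤ) (Q : BinForm) (p q r s : ℤ) :
    (Q.subst p q (N * r) s).scale N = (Q.scale N).subst p (N * q) r s := by
  ext <;> simp only [scale, subst, eval] <;> ring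

theorem scale_injective {N : ℤ} (hN : N ≠ 0) : Function.Injective (scale N) := by
  intro Q Q' h
  simp only [scale, mk.injEq] at h
  obtain ⟨h1, h2, h3⟩ := h
  exact BinForm.ext h1 (mul_left_cancel₀ hN h2) (mul_left_cancel₀ (pow_ne_zero 2 hN) h3)

/-- A matrix carrying one scaled form to another one has upper right entry divisible by the
scaling factor. -/
theorem dvd_of_scale_eq_subst {N : ℤ} (hN : N ≠ 0) {Q Q' : BinForm} (ha : IsCoprime Q.a N)
    {p q r s : ℤ} (h : Q'.scale N = (Q.scale N).subst p q r s) : N ∣ q := by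
  have hc : N ^ 2 * Q'.c = Q.a * q ^ 2 + N * Q.b * q * s + N ^ 2 * Q.c * s ^ 2 :=
    congrArg BinForm.c h
  -- With `N = n d` and `q = t d`, comparing last coefficients gives `n ∣ a t²`; since `n` is prime
  -- to both `a` and `t`, it is a unit.
  obtain ⟨d, n, t, hd, hnt, rfl, rfl⟩ :=
    Int.exists_gcd_one' (m := N) (n := q) (Int.gcd_pos_of_ne_zero_left _ hN)
  have hd0 : (d : ℤ) ^ 2 ≠ 0 := by positivity
  have hdvd : n ∣ Q.a * t ^ 2 := by
    refine ⟨n * Q'.c - Q.b * t * s - n * Q.c * s ^ 2, mul_left_cancel₀ hd0 ?_⟩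
    linear_combination -hc
  have hn : IsUnit n := by
    refine IsCoprime.isUnit_of_dvd' ?_ dvd_rfl hdvd
    exact ha.symm.of_mul_left_left.mul_right (Int.isCoprime_iff_gcd_eq_one.2 hnt).pow_right
  obtain ⟨n, rfl⟩ := hn
  exact (Units.mul_left_dvd).2 (Dvd.intro_left _ rfl)

/-! ### Lattices of forms up to homothety -/

/-- The square root of `D` in the upper half plane, for `D < 0`. -/
noncomputable def rootDisc (D : ℤ) : ℂ := (Real.sqrt (-D) : ℝ) * I

theorem rootDisc_sq {D : ℤ} (hD : D < 0) : rootDisc D ^ 2 = D := by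
  have h : (0 : ℝ) ≤ -D := by
    have : (D : ℝ) < 0 := by exact_mod_cast hD
    linarith
  rw [rootDisc, mul_pow, I_sq, ← ofReal_pow, Real.sq_sqrt h]
  push_cast; ring

theorem rootDisc_im_pos {D : ℤ} (hD : D < 0) : 0 < (rootDisc D).im := by
  have : (D : ℝ) < 0 := by exact_mod_cast hD
  simp [rootDisc, this]

@[simp] theorem rootDisc_re (D : ℤ) : (rootDisc D).re = 0 := by simp [rootDisc]

/-- `(-b + √D) / 2`, where `D` is the discriminant of the form. -/
noncomputable def theta (f : BinForm) : ℂ := (-f.b + rootDisc f.disc) / 2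

theorem theta_sq {f : BinForm} (hf : f.disc < 0) : f.theta ^ 2 = -f.b * f.theta - f.a * f.c := by
  have h := rootDisc_sq hf
  have h2 : (f.disc : ℂ) = f.b ^ 2 - 4 * f.a * f.c := by simp [disc]
  rw [h2] at h
  rw [theta]
  linear_combination h / 4

theorem theta_im (f : BinForm) : f.theta.im = (rootDisc f.disc).im / 2 := by
  simp [theta]

theorem theta_re (f : BinForm) : f.theta.re = -f.b / 2 := by
  simp [theta]

/-- The lattice spanned by `a` and `(-b + √D) / 2`. -/
noncomputable def lattice (f : BinForm) : Submodule ℤ ℂ := Submodule.span ℤ {(f.a : ℂ), f.theta}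

/-- Lattices in `ℂ` up to homothety, as a congruence on the monoid of lattices. -/
noncomputable def homothety : Con (Submodule ℤ ℂ) where
  r L L' := ∃ u : ℂ, u ≠ 0 ∧ Submodule.span ℤ {u} * L = L'
  iseqv := by
    refine ⟨fun L => ⟨1, one_ne_zero, ?_⟩, ?_, ?_⟩
    · rw [← Submodule.one_eq_span, one_mul]
    · rintro L _ ⟨u, hu, rfl⟩
      refine ⟨u⁻¹, inv_ne_zero hu, ?_⟩
      rw [← mul_assoc, Submodule.span_mul_span, Set.singleton_mul_singleton, inv_mul_cancel₀ hu,
        ← Submodule.one_eq_span, one_mul]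
    · rintro L _ _ ⟨u, hu, rfl⟩ ⟨v, hv, rfl⟩
      refine ⟨v * u, mul_ne_zero hv hu, ?_⟩
      rw [← mul_assoc, Submodule.span_mul_span, Set.singleton_mul_singleton]
  mul' := by
    rintro L _ M _ ⟨u, hu, rfl⟩ ⟨v, hv, rfl⟩
    refine ⟨u * v, mul_ne_zero hu hv, ?_⟩
    rw [← Set.singleton_mul_singleton, ← Submodule.span_mul_span, mul_mul_mul_comm]

theorem homothety_iff {L L' : Submodule ℤ ℂ} :
    homothety L L' ↔ ∃ u : ℂ, u ≠ 0 ∧ Submodule.span ℤ {u} * L = L' := Iff.rfl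

theorem span_singleton_mul_span_pair (u x y : ℂ) :
    Submodule.span ℤ {u} * Submodule.span ℤ {x, y} = Submodule.span ℤ {u * x, u * y} := by
  rw [Submodule.span_mul_span, Set.singleton_mul, Set.image_pair]

theorem span_pair_le {x y : ℂ} {L : Submodule ℤ ℂ} :
    Submodule.span ℤ {x, y} ≤ L ↔ x ∈ L ∧ y ∈ L := by
  rw [Submodule.span_le, Set.pair_subset_iff]; rfl

theorem mem_span_pair_int {x y z : ℂ} :
    z ∈ Submodule.span ℤ {x, y} ↔ ∃ m n : ℤ, (m : ℂ) * x + n * y = z := by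
  simp [Submodule.mem_span_pair]

theorem span_pair_det_one (x y : ℂ) {p q r s : ℤ} (h : p * s - q * r = 1) :
    Submodule.span ℤ {p * x - r * y, s * y - q * x} = Submodule.span ℤ {x, y} := by
  have h' : (p * s - q * r : ℂ) = 1 := by exact_mod_cast h
  apply le_antisymm <;> rw [span_pair_le] <;> simp only [mem_span_pair_int]
  · exact ⟨⟨p, -r, by push_cast; ring⟩, ⟨-q, s, by push_cast; ring⟩⟩
  · exact ⟨⟨s, r, by linear_combination x * h'⟩, ⟨q, p, by linear_combination y * h'⟩⟩

/-! ### Proper equivalence versus homothety -/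

/-- The factor by which a substitution scales the lattice of a form. -/
theorem subst_scaling {f : BinForm} (ha : f.a ≠ 0) (hf : f.disc < 0) {p q r s : ℤ}
    (h : p * s - q * r = 1) :
    ((f.subst p q r s).a : ℂ) =
        (p * f.a + r * f.b + r * f.theta) / f.a * (p * f.a - r * f.theta) ∧
      (f.subst p q r s).theta =
        (p * f.a + r * f.b + r * f.theta) / f.a * (s * f.theta - q * f.a) := by
  have ha' : (f.a : ℂ) ≠ 0 := by exact_mod_cast ha
  have h' : (p * s - q * r : ℂ) = 1 := by exact_mod_cast h
  have hθ := theta_sq hf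
  have hw : rootDisc f.disc = 2 * f.theta + f.b := by rw [theta]; ring
  constructor
  · rw [div_mul_eq_mul_div, eq_div_iff ha']
    simp only [subst, eval]
    push_cast
    linear_combination (r : ℂ) ^ 2 * hθ
  · rw [div_mul_eq_mul_div, eq_div_iff ha', theta, disc_subst _ h, hw]
    simp only [subst]
    push_cast
    linear_combination (-(r : ℂ) * s) * hθ - (f.a * f.theta + f.a * f.b / 2) * h'

theorem homothety_lattice_subst {f : BinForm} (hf : f.disc < 0)
    {p q r s : ℤ} (h : p * s - q * r = 1) (ha : f.a ≠ 0) (ha' : (f.subst p q r s).a ≠ 0) :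
    homothety f.lattice (f.subst p q r s).lattice := by
  obtain ⟨h1, h2⟩ := subst_scaling ha hf h
  refine homothety_iff.2 ⟨(p * f.a + r * f.b + r * f.theta) / f.a, ?_, ?_⟩
  · intro h0
    rw [h0, zero_mul] at h1
    exact ha' (by exact_mod_cast h1)
  · rw [lattice, lattice, ← span_pair_det_one _ _ h, span_singleton_mul_span_pair, h1, h2]

/-- The oriented area of a transformed pair. -/
theorem im_conj_mul_transform (u x y : ℂ) (p q r s : ℝ) :
    (starRingEnd ℂ (u * (p * x + q * y)) * (u * (r * x + s * y))).im =
      normSq u * (p * s - q * r) * (starRingEnd ℂ x * y).im := by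
  simp [normSq_apply]; ring

/-- A homothety identifies two bases with the same orientation, so the change of basis has
determinant `1`. A form of given discriminant with `a > 0` is then recovered from the ratio of its
basis vectors. -/
theorem exists_subst_of_homothety {f g : BinForm} (hfg : f.disc = g.disc) (hf : f.disc < 0)
    (hfa : 0 < f.a) (hga : 0 < g.a) (h : homothety f.lattice g.lattice) :
    ∃ p q r s : ℤ, p * s - q * r = 1 ∧ g = f.subst p q r s := by
  obtain ⟨u, hu, hL⟩ := homothety_iff.1 h
  rw [lattice, lattice, span_singleton_mul_span_pair] at hL
  have hle := span_pair_le.1 hL.le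
  have hge := span_pair_le.1 hL.ge
  simp only [mem_span_pair_int] at hle hge
  obtain ⟨⟨k, l, h1⟩, ⟨m, n, h2⟩⟩ := hle
  obtain ⟨⟨p, r, h3⟩, ⟨q, s, h4⟩⟩ := hge
  have hw := rootDisc_im_pos hf
  have hx : (starRingEnd ℂ (f.a : ℂ) * f.theta).im = f.a * ((rootDisc f.disc).im / 2) := by
    simp [theta_im]
  have hy : (starRingEnd ℂ (g.a : ℂ) * g.theta).im = g.a * ((rootDisc f.disc).im / 2) := by
    simp [theta_im, hfg]
  have hfa' : (0 : ℝ) < f.a := by exact_mod_cast hfa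
  have hga' : (0 : ℝ) < g.a := by exact_mod_cast hga
  -- Comparing oriented areas in both directions shows that the determinant is positive and that the
  -- two integer determinants have product `1`.
  have e1 := im_conj_mul_transform u f.a f.theta p r q s
  have e2 := im_conj_mul_transform u⁻¹ g.a g.theta k l m n
  have h3' : u * ((p : ℝ) * (f.a : ℂ) + (r : ℝ) * f.theta) = g.a := by
    rw [← h3]; push_cast; ring
  have h4' : u * ((q : ℝ) * (f.a : ℂ) + (s : ℝ) * f.theta) = g.theta := by
    rw [← h4]; push_cast; ring
  have h1' : u⁻¹ * ((k : ℝ) * (g.a : ℂ) + (l : ℝ) * g.theta) = f.a := by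
    rw [inv_mul_eq_iff_eq_mul₀ hu, ← h1]; push_cast; ring
  have h2' : u⁻¹ * ((m : ℝ) * (g.a : ℂ) + (n : ℝ) * g.theta) = f.theta := by
    rw [inv_mul_eq_iff_eq_mul₀ hu, ← h2]; push_cast; ring
  rw [h3', h4', hx, hy] at e1
  rw [h1', h2', hx, hy, map_inv₀] at e2
  have hU : 0 < normSq u := normSq_pos.2 hu
  set A := f.a * ((rootDisc f.disc).im / 2) with hA
  set B := g.a * ((rootDisc f.disc).im / 2) with hB
  have hA0 : 0 < A := by positivity
  have hB0 : 0 < B := by positivity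
  have hdet : 0 < (p * s - r * q : ℝ) := by
    by_contra hneg
    have : normSq u * (p * s - r * q) * A ≤ 0 :=
      mul_nonpos_of_nonpos_of_nonneg (mul_nonpos_of_nonneg_of_nonpos hU.le (not_lt.1 hneg)) hA0.le
    linarith
  have hprod : (p * s - r * q : ℝ) * (k * n - l * m) = 1 := by
    rw [e1] at e2
    have : A * 1 = A * ((p * s - r * q : ℝ) * (k * n - l * m)) := by
      conv_lhs => rw [mul_one, e2]
      field_simp
    exact (mul_left_cancel₀ hA0.ne' this).symm
  have hdetZ : p * s - r * q = 1 := by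
    have h0 : 0 < p * s - r * q := by exact_mod_cast hdet
    have hp : (p * s - r * q) * (k * n - l * m) = 1 := by exact_mod_cast hprod
    exact Int.eq_one_of_mul_eq_one_right h0.le hp
  have hdet1 : p * s - (-q) * (-r) = 1 := by rw [← hdetZ]; ring
  refine ⟨p, -q, -r, s, hdet1, ?_⟩
  obtain ⟨t1, t2⟩ := subst_scaling hfa.ne' hf hdet1
  have hd : (f.subst p (-q) (-r) s).disc = f.disc := disc_subst _ hdet1
  set F := f.subst p (-q) (-r) s
  -- Both bases are complex multiples of the same pair. Imaginary parts then give equal `a`, real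
  -- parts equal `b`, and the discriminant equal `c`.
  have key : (F.a : ℂ) * g.theta = g.a * F.theta := by
    rw [t1, t2, ← h3', ← h4']; push_cast; ring
  have ka : F.a = g.a := by
    have := congrArg Complex.im key
    have e (n : ℤ) (z : ℂ) : ((n : ℂ) * z).im = n * z.im := by simp
    rw [e, e, theta_im, theta_im, hd, ← hfg] at this
    exact_mod_cast mul_right_cancel₀ (by positivity) this
  have kb : F.b = g.b := by
    rw [ka] at key
    have := congrArg Complex.re (mul_left_cancel₀ (by exact_mod_cast hga.ne') key)
    rw [theta_re, theta_re] at this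
    have h5 : (F.b : ℝ) = g.b := by linarith
    exact_mod_cast h5
  have kc : F.c = g.c := by
    rw [hfg] at hd
    simp only [disc, ka, kb] at hd
    have : g.a * F.c = g.a * g.c := by linarith
    exact mul_left_cancel₀ hga.ne' this
  exact (BinForm.ext ka kb kc).symm

/-! ### Products of lattices -/

/-- The product is generated by `a a'`, `a θ`, `a' θ` and `θ² = -B θ - a a' C`, thus by `a a'` and
the multiples of `θ` by `a`, `a'`, `B`, which are jointly coprime. -/
theorem span_pair_mul_span_pair_of_sq {a a' B C u v t : ℤ} {θ : ℂ}
    (hθ : θ ^ 2 = -B * θ - a * a' * C) (h : u * a + v * a' + t * B = 1) :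
    Submodule.span ℤ {(a : ℂ), θ} * Submodule.span ℤ {(a' : ℂ), θ} =
      Submodule.span ℤ {(a * a' : ℂ), θ} := by
  have h' : (u * a + v * a' + t * B : ℂ) = 1 := by exact_mod_cast h
  have hl : ∀ x y : ℂ, x ∈ Submodule.span ℤ {x, y} := fun x y => Submodule.subset_span (by simp)
  have hr : ∀ x y : ℂ, y ∈ Submodule.span ℤ {x, y} := fun x y => Submodule.subset_span (by simp)
  apply le_antisymm
  · rw [Submodule.span_mul_span, Submodule.span_le]
    rintro _ ⟨x, hx, y, hy, rfl⟩
    simp only [Set.mem_insert_iff, Set.mem_singleton_iff] at hx hy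
    simp only [SetLike.mem_coe, mem_span_pair_int]
    rcases hx with rfl | rfl <;> rcases hy with rfl | rfl
    · exact ⟨1, 0, by simp⟩
    · exact ⟨0, a, by simp⟩
    · exact ⟨0, a', by push_cast; ring⟩
    · exact ⟨-C, -B, by push_cast; linear_combination -hθ⟩
  · rw [span_pair_le]
    refine ⟨Submodule.mul_mem_mul (hl _ _) (hl _ _), ?_⟩
    have m1 := Submodule.mul_mem_mul (hl (a : ℂ) θ) (hl (a' : ℂ) θ)
    have m2 := Submodule.mul_mem_mul (hl (a : ℂ) θ) (hr (a' : ℂ) θ)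
    have m3 := Submodule.mul_mem_mul (hr (a : ℂ) θ) (hl (a' : ℂ) θ)
    have m4 := Submodule.mul_mem_mul (hr (a : ℂ) θ) (hr (a' : ℂ) θ)
    have := Submodule.add_mem _ (Submodule.add_mem _ (Submodule.smul_mem _ u m2)
      (Submodule.smul_mem _ v m3)) (Submodule.add_mem _ (Submodule.smul_mem _ (-t) m4)
      (Submodule.smul_mem _ (-t * C) m1))
    convert this using 1
    simp only [zsmul_eq_mul]
    push_cast
    linear_combination (-θ) * h' + t * hθ

theorem span_pair_sub_mul (x y : ℂ) (k : ℤ) :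
    Submodule.span ℤ {x, y - k * x} = Submodule.span ℤ {x, y} := by
  simpa using span_pair_det_one x y (p := 1) (q := k) (r := 0) (s := 1) (by ring)

/-- The lattice of a form depends on `b` only modulo `2 a`. -/
theorem lattice_eq_span {f : BinForm} {B k : ℤ} (h : f.b = B + 2 * f.a * k) :
    f.lattice = Submodule.span ℤ {(f.a : ℂ), (-B + rootDisc f.disc) / 2} := by
  rw [lattice, ← span_pair_sub_mul _ ((-B + rootDisc f.disc) / 2) k, theta, h]
  congr 3
  push_cast; ring

theorem lattice_mul_lattice {f f' f'' : BinForm} (hd : f.disc = f''.disc)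
    (hd' : f'.disc = f''.disc) (hneg : f''.disc < 0) (ha : f''.a = f.a * f'.a)
    {k k' : ℤ} (hb : f.b = f''.b + 2 * f.a * k) (hb' : f'.b = f''.b + 2 * f'.a * k')
    {u v t : ℤ} (h : u * f.a + v * f'.a + t * f''.b = 1) :
    f.lattice * f'.lattice = f''.lattice := by
  have hθ := theta_sq hneg
  rw [lattice_eq_span hb, lattice_eq_span hb', hd, hd', lattice, ha]
  change Submodule.span ℤ {_, f''.theta} * Submodule.span ℤ {_, f''.theta} = _
  rw [span_pair_mul_span_pair_of_sq (C := f''.c) _ h]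
  · push_cast; rfl
  · rw [hθ, ha]; push_cast; rfl

theorem opposite_disc (f : BinForm) : f.opposite.disc = f.disc := by
  simp [disc, opposite]

/-- The opposite form has `θ + b`, the negative conjugate of `θ`. As `θ (θ + b) = -a c`, the product
is `a` times the span of `a`, `b`, `c`, `θ`, which is `ℤ + ℤ θ` by primitivity. -/
theorem homothety_mul_opposite {f g : BinForm} (ha : f.a ≠ 0) (hf : f.disc < 0)
    (hd : g.disc = f.disc) (hg : g.a = 1) {u v t : ℤ}
    (h : u * f.a + v * f.b + t * f.c = 1) :
    homothety g.lattice (f.lattice * f.opposite.lattice) := by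
  have h' : (u * f.a + v * f.b + t * f.c : ℂ) = 1 := by exact_mod_cast h
  -- Equal discriminants force middle coefficients of equal parity, so `g.lattice` is spanned by `1`
  -- and `f.theta`.
  have hpar : ∃ k, g.b = f.b + 2 * g.a * k := by
    have h4 : g.b ^ 2 - 4 * g.a * g.c = f.b ^ 2 - 4 * f.a * f.c := hd
    have : Even (g.b ^ 2 - f.b ^ 2) := ⟨2 * (g.a * g.c - f.a * f.c), by linarith⟩
    rw [Int.even_sub, Int.even_pow' two_ne_zero, Int.even_pow' two_ne_zero, ← Int.even_sub] at this
    obtain ⟨k, hk⟩ := this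
    exact ⟨k, by rw [hg]; linarith⟩
  obtain ⟨k, hk⟩ := hpar
  have hθ := theta_sq hf
  have ho : f.opposite.theta = f.theta + f.b := by
    rw [theta, theta, opposite_disc, opposite]; push_cast; ring
  refine homothety_iff.2 ⟨f.a, by exact_mod_cast ha, ?_⟩
  rw [lattice_eq_span hk, hd, hg]
  change _ * Submodule.span ℤ {_, f.theta} = Submodule.span ℤ {(f.a : ℂ), f.theta} *
    Submodule.span ℤ {(f.a : ℂ), f.opposite.theta}
  rw [ho, span_singleton_mul_span_pair]
  have hl : ∀ x y : ℂ, x ∈ Submodule.span ℤ {x, y} := fun x y => Submodule.subset_span (by simp)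
  have hr : ∀ x y : ℂ, y ∈ Submodule.span ℤ {x, y} := fun x y => Submodule.subset_span (by simp)
  apply le_antisymm
  · have m1 := Submodule.mul_mem_mul (hl (f.a : ℂ) f.theta) (hl (f.a : ℂ) (f.theta + f.b))
    have m2 := Submodule.mul_mem_mul (hl (f.a : ℂ) f.theta) (hr (f.a : ℂ) (f.theta + f.b))
    have m3 := Submodule.mul_mem_mul (hr (f.a : ℂ) f.theta) (hl (f.a : ℂ) (f.theta + f.b))
    have m4 := Submodule.mul_mem_mul (hr (f.a : ℂ) f.theta) (hr (f.a : ℂ) (f.theta + f.b))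
    rw [span_pair_le]
    constructor
    · have := Submodule.add_mem _ (Submodule.add_mem _ (Submodule.smul_mem _ u m1)
        (Submodule.smul_mem _ v (Submodule.sub_mem _ m2 m3))) (Submodule.smul_mem _ (-t) m4)
      convert this using 1
      simp only [zsmul_eq_mul]
      push_cast
      linear_combination (-(f.a : ℂ)) * h' + t * hθ
    · convert m3 using 1; ring
  · rw [Submodule.span_mul_span, Submodule.span_le]
    rintro _ ⟨x, hx, y, hy, rfl⟩
    simp only [Set.mem_insert_iff, Set.mem_singleton_iff] at hx hy
    simp only [SetLike.mem_coe, mem_span_pair_int]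
    rcases hx with rfl | rfl <;> rcases hy with rfl | rfl
    · exact ⟨f.a, 0, by push_cast; ring⟩
    · exact ⟨f.b, 1, by push_cast; ring⟩
    · exact ⟨0, 1, by push_cast; ring⟩
    · exact ⟨-f.c, 0, by push_cast; linear_combination -hθ⟩

/-! ### Primitive forms and the values they represent -/

theorem isPrimitive_iff_forall_prime {f : BinForm} :
    f.IsPrimitive ↔ ∀ p : ℕ, p.Prime → (p : ℤ) ∣ f.a → (p : ℤ) ∣ f.b → ¬ (p : ℤ) ∣ f.c := by
  constructor
  · intro h p hp h1 h2 h3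
    have := Int.dvd_coe_gcd (Int.dvd_coe_gcd h1 h2) h3
    rw [h] at this
    exact hp.one_lt.ne' (by exact_mod_cast Int.eq_one_of_dvd_one (by positivity) this)
  · intro h
    by_contra h1
    obtain ⟨p, hp, hdvd⟩ := Nat.exists_prime_and_dvd h1
    have hdvd' : (p : ℤ) ∣ Int.gcd (Int.gcd f.a f.b : ℤ) f.c := Int.natCast_dvd_natCast.2 hdvd
    have hab := hdvd'.trans (Int.gcd_dvd_left _ _)
    exact h p hp (hab.trans (Int.gcd_dvd_left _ _)) (hab.trans (Int.gcd_dvd_right _ _))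
      (hdvd'.trans (Int.gcd_dvd_right _ _))

theorem exists_eq_one_of_gcd_gcd {a b c : ℤ} (h : Int.gcd (Int.gcd a b : ℤ) c = 1) :
    ∃ u v t : ℤ, u * a + v * b + t * c = 1 := by
  obtain ⟨x, y, hxy⟩ := Int.isCoprime_iff_gcd_eq_one.2 h
  refine ⟨x * Int.gcdA a b, x * Int.gcdB a b, y, ?_⟩
  rw [Int.gcd_eq_gcd_ab] at hxy
  linear_combination hxy

theorem IsPosDef.a_pos {f : BinForm} (h : f.IsPosDef) : 0 < f.a := by
  simpa [eval] using h 1 0 (by simp)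

theorem IsPosDef.a_subst_pos {f : BinForm} (h : f.IsPosDef) {p q r s : ℤ}
    (hdet : p * s - q * r = 1) : 0 < (f.subst p q r s).a := by
  refine h p r ?_
  by_contra! h0
  simp [h0.1, h0.2] at hdet

theorem subst_subst_inv (f : BinForm) {p q r s : ℤ} (h : p * s - q * r = 1) :
    (f.subst p q r s).subst s (-q) (-r) p = f := by
  refine ext_eval fun x y => ?_
  rw [eval_subst, eval_subst]
  congr 1
  · linear_combination x * h
  · linear_combination y * h

theorem IsPrimitive.of_subst {f : BinForm} {p q r s : ℤ} (h : (f.subst p q r s).IsPrimitive) :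
    f.IsPrimitive := by
  rw [isPrimitive_iff_forall_prime] at h ⊢
  rintro l hl ⟨a, ha⟩ ⟨b, hb⟩ ⟨c, hc⟩
  refine h l hl ⟨(⟨a, b, c⟩ : BinForm).eval p r, ?_⟩
    ⟨2 * a * p * q + b * (p * s + q * r) + 2 * c * r * s, ?_⟩
    ⟨(⟨a, b, c⟩ : BinForm).eval q s, ?_⟩ <;> simp only [subst, eval, ha, hb, hc] <;> ring

theorem IsPrimitive.subst {f : BinForm} (hf : f.IsPrimitive) {p q r s : ℤ}
    (h : p * s - q * r = 1) : (f.subst p q r s).IsPrimitive := by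
  rw [← subst_subst_inv f h] at hf
  exact hf.of_subst

theorem IsPrimitive.scale {Q : BinForm} (hQ : Q.IsPrimitive) {N : ℤ} (ha : IsCoprime Q.a N) :
    (Q.scale N).IsPrimitive := by
  rw [isPrimitive_iff_forall_prime] at hQ ⊢
  intro p hp h1 h2 h3
  have hp' : Prime (p : ℤ) := Nat.prime_iff_prime_int.1 hp
  have hN : ¬ (p : ℤ) ∣ N := fun h => hp'.not_isUnit (ha.isUnit_of_dvd' h1 h)
  exact hQ p hp h1 ((hp'.dvd_or_dvd h2).resolve_left hN)
    ((hp'.dvd_or_dvd h3).resolve_left fun h => hN (hp'.dvd_of_dvd_pow h))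

/-- A primitive form properly represents numbers prime to any given number. -/
theorem IsPrimitive.exists_isCoprime_eval {f : BinForm} (hf : f.IsPrimitive) {M : ℤ}
    (hM : M ≠ 0) : ∃ x y : ℤ, IsCoprime x y ∧ IsCoprime (f.eval x y) M := by
  classical
  rw [isPrimitive_iff_forall_prime] at hf
  let S : Finset ℕ := M.natAbs.primeFactors
  -- For each prime `p ∣ M`, only one term of the value survives modulo `p`: `a x²` if `p ∤ a`, `c
  -- y²` if `p ∣ a` and `p ∤ c`, and `b x y` if `p` divides both. The primes put into `x` and `y`
  -- are disjoint, so these are coprime.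
  let P : ℕ → Prop := fun p => (p : ℤ) ∣ f.a ∧ ¬ (p : ℤ) ∣ f.c
  let P' : ℕ → Prop := fun p => ¬ (p : ℤ) ∣ f.a
  let prod : (ℕ → Prop) → ℤ := fun P => ∏ p ∈ S.filter P, Nat.cast p
  let x : ℤ := prod P
  let y : ℤ := prod P'
  have hprod : ∀ (P : ℕ → Prop) (p : ℕ), p.Prime →
      ((p : ℤ) ∣ prod P ↔ p ∈ S ∧ P p) := by
    intro P p hp
    rw [(Nat.prime_iff_prime_int.1 hp).dvd_finsetProd_iff, ← Finset.mem_filter]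
    constructor
    · rintro ⟨q, hq, hpq⟩
      have hq' : q.Prime := Nat.prime_of_mem_primeFactors (Finset.mem_filter.1 hq).1
      rwa [(Nat.prime_dvd_prime_iff_eq hp hq').1 (Int.natCast_dvd_natCast.1 hpq)]
    · exact fun h => ⟨p, h, dvd_rfl⟩
  have hcop : ∀ m n : ℤ, (∀ p : ℕ, p.Prime → (p : ℤ) ∣ m → ¬ (p : ℤ) ∣ n) → IsCoprime m n := by
    intro m n h
    rw [Int.isCoprime_iff_gcd_eq_one]
    refine Nat.Coprime.eq_one_of_dvd ?_ dvd_rfl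
    refine Nat.Coprime.symm (Nat.coprime_of_dvd fun p hp h1 _ => ?_)
    have h1' : (p : ℤ) ∣ Int.gcd m n := Int.natCast_dvd_natCast.2 h1
    exact h p hp (h1'.trans (Int.gcd_dvd_left _ _)) (h1'.trans (Int.gcd_dvd_right _ _))
  refine ⟨x, y, hcop _ _ fun p hp h1 h2 => ?_, hcop _ _ fun p hp h1 h2 => ?_⟩
  · exact ((hprod P' p hp).1 h2).2 ((hprod P p hp).1 h1).2.1
  · have hp' : Prime (p : ℤ) := Nat.prime_iff_prime_int.1 hp
    have hpS : p ∈ S :=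
      Nat.mem_primeFactors.2 ⟨hp, Int.natCast_dvd.1 h2, Int.natAbs_ne_zero.2 hM⟩
    have hx : (p : ℤ) ∣ x ↔ (p : ℤ) ∣ f.a ∧ ¬ (p : ℤ) ∣ f.c := by
      exact (hprod P p hp).trans (and_iff_right hpS)
    have hy : (p : ℤ) ∣ y ↔ ¬ (p : ℤ) ∣ f.a := by
      exact (hprod P' p hp).trans (and_iff_right hpS)
    simp only [eval] at h1
    by_cases ha : (p : ℤ) ∣ f.a
    · have hy' : ¬ (p : ℤ) ∣ y := fun h => hy.1 h ha
      have h3 : (p : ℤ) ∣ y * (f.b * x + f.c * y) := by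
        have := dvd_sub h1 (ha.mul_right (x ^ 2))
        rwa [show f.a * x ^ 2 + f.b * x * y + f.c * y ^ 2 - f.a * x ^ 2 =
          y * (f.b * x + f.c * y) by ring] at this
      have h4 := (hp'.dvd_or_dvd h3).resolve_left hy'
      by_cases hc : (p : ℤ) ∣ f.c
      · have hx' : ¬ (p : ℤ) ∣ x := fun h => (hx.1 h).2 hc
        have h5 : (p : ℤ) ∣ f.b * x := (dvd_add_left (hc.mul_right y)).1 h4
        exact hf p hp ha ((hp'.dvd_or_dvd h5).resolve_right hx') hc
      · have hx' : (p : ℤ) ∣ x := hx.2 ⟨ha, hc⟩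
        have h5 : (p : ℤ) ∣ f.c * y := (dvd_add_right (hx'.mul_left f.b)).1 h4
        exact (hp'.dvd_or_dvd h5).elim hc hy'
    · have hy' : (p : ℤ) ∣ y := hy.2 ha
      have hx' : ¬ (p : ℤ) ∣ x := fun h => ha (hx.1 h).1
      have h3 : (p : ℤ) ∣ f.a * x ^ 2 := by
        have := dvd_sub h1 (hy'.mul_right (f.b * x + f.c * y))
        rwa [show f.a * x ^ 2 + f.b * x * y + f.c * y ^ 2 - y * (f.b * x + f.c * y) =
          f.a * x ^ 2 by ring] at this
      exact (hp'.dvd_or_dvd h3).elim ha fun h => hx' (hp'.dvd_of_dvd_pow h)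

/-! ### Classes of forms as homothety classes of lattices -/

section Classes

variable {D : ℤ} {N : ℕ}

theorem isCoprime_a {Q : BinForm} (hQ : Q ∈ QFCoprime D N) : IsCoprime Q.a N :=
  Int.isCoprime_iff_gcd_eq_one.2 hQ.2

theorem mem_QFCoprime_of_a_pos {Q : BinForm} (hD : D < 0) (h : Q.IsPrimitive) (ha : 0 < Q.a)
    (hd : Q.disc = D) (hN : IsCoprime Q.a N) : Q ∈ QFCoprime D N :=
  ⟨⟨h, isPosDef_of_disc_neg ha (hd ▸ hD), hd⟩, Int.isCoprime_iff_gcd_eq_one.1 hN⟩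

theorem cls_eq_cls_iff {Q Q' : BinForm} (hQ : Q ∈ QFCoprime D N) (hQ' : Q' ∈ QFCoprime D N) :
    cls Q hQ = cls Q' hQ' ↔ GammaEquiv (CongruenceSubgroup.Gamma0 N) Q Q' :=
  Quotient.eq (r := gammaSetoid D N)

theorem exists_cls_eq (X : FormClass D N) : ∃ (Q : BinForm) (hQ : Q ∈ QFCoprime D N),
    cls Q hQ = X := by
  obtain ⟨⟨Q, hQ⟩, rfl⟩ := Quotient.exists_rep X
  exact ⟨Q, hQ, rfl⟩

theorem exists_cls_eq_isCoprime (hD : D < 0) (hN : 0 < N) {Q : BinForm}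
    (hQ : Q ∈ QFCoprime D N) {M : ℤ} (hM : M ≠ 0) :
    ∃ (Q' : BinForm) (hQ' : Q' ∈ QFCoprime D N), cls Q hQ = cls Q' hQ' ∧ IsCoprime Q'.a M := by
  have hN' : (N : ℤ) ≠ 0 := by exact_mod_cast hN.ne'
  -- A value of the scaled form is a value of `Q` at `(x, N y)`, the first column of a matrix in
  -- `Γ₀(N)`. Asking it to be prime to `N` too makes `x` prime to `N`, so that the column can be
  -- completed.
  obtain ⟨x, y, hxy, hM'⟩ :=
    (hQ.1.1.scale (isCoprime_a hQ)).exists_isCoprime_eval (mul_ne_zero hM hN')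
  have hev : (Q.scale N).eval x y = Q.eval x (N * y) := by simp only [scale, eval]; ring
  rw [hev] at hM'
  have hxN : IsCoprime x N := by
    obtain ⟨u, v, h⟩ := hM'.of_mul_right_right
    refine ⟨u * (Q.a * x + Q.b * (N * y)), u * Q.c * N * y ^ 2 + v, ?_⟩
    rw [← h, eval]; ring
  obtain ⟨s, q, h⟩ := hxN.mul_right hxy
  have hdet : x * s - (-q) * (N * y) = 1 := by rw [← h]; ring
  have hmem : Q.subst x (-q) (N * y) s ∈ QFCoprime D N :=
    mem_QFCoprime_of_a_pos hD (hQ.1.1.subst hdet) (hQ.1.2.1.a_subst_pos hdet)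
      ((disc_subst Q hdet).trans hQ.1.2.2) hM'.of_mul_right_right
  exact ⟨_, hmem, (cls_eq_cls_iff hQ hmem).2 (gammaEquiv_Gamma0_iff.2 ⟨_, _, _, _, hdet, rfl⟩),
    hM'.of_mul_right_left⟩

theorem disc_scale_of_mem {Q : BinForm} (hQ : Q ∈ QFCoprime D N) :
    (Q.scale N).disc = N ^ 2 * D := by
  rw [disc_scale, hQ.1.2.2]

theorem disc_scale_neg (hD : D < 0) (hN : 0 < N) {Q : BinForm} (hQ : Q ∈ QFCoprime D N) :
    (Q.scale N).disc < 0 := by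
  rw [disc_scale_of_mem hQ]
  exact mul_neg_of_pos_of_neg (by positivity) hD

theorem gammaEquiv_iff_homothety (hD : D < 0) (hN : 0 < N) {Q Q' : BinForm}
    (hQ : Q ∈ QFCoprime D N) (hQ' : Q' ∈ QFCoprime D N) :
    GammaEquiv (CongruenceSubgroup.Gamma0 N) Q Q' ↔
      homothety (Q.scale N).lattice (Q'.scale N).lattice := by
  have hN' : (N : ℤ) ≠ 0 := by exact_mod_cast hN.ne'
  rw [gammaEquiv_Gamma0_iff]
  constructor
  · rintro ⟨p, q, r, s, hdet, rfl⟩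
    have ha' := hQ'.1.2.1.a_pos.ne'
    rw [scale_subst]
    refine homothety_lattice_subst (disc_scale_neg hD hN hQ) (by rw [← hdet]; ring)
      hQ.1.2.1.a_pos.ne' ?_
    rwa [← scale_subst]
  · intro h
    obtain ⟨p, q, r, s, hdet, h⟩ := exists_subst_of_homothety
      ((disc_scale_of_mem hQ).trans (disc_scale_of_mem hQ').symm) (disc_scale_neg hD hN hQ)
      hQ.1.2.1.a_pos hQ'.1.2.1.a_pos h
    obtain ⟨q, rfl⟩ := dvd_of_scale_eq_subst hN' (isCoprime_a hQ) h
    refine ⟨p, q, r, s, by rw [← hdet]; ring, scale_injective hN' ?_⟩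
    rw [h, scale_subst]

/-- The homothety class of the lattice attached to a class of forms. -/
noncomputable def latticeClass (hD : D < 0) (hN : 0 < N) (X : FormClass D N) :
    homothety.Quotient :=
  Quotient.lift (s := gammaSetoid D N) (fun Q => (((Q.1.scale N).lattice : _) : homothety.Quotient))
    (fun Q Q' h => (Con.eq _).2 ((gammaEquiv_iff_homothety hD hN Q.2 Q'.2).1 h)) X

theorem latticeClass_cls (hD : D < 0) (hN : 0 < N) {Q : BinForm} (hQ : Q ∈ QFCoprime D N) :
    latticeClass hD hN (cls Q hQ) = ((Q.scale N).lattice : homothety.Quotient) := rfl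

theorem latticeClass_injective (hD : D < 0) (hN : 0 < N) :
    Function.Injective (latticeClass (D := D) hD hN) := by
  intro X Y h
  obtain ⟨Q, hQ, rfl⟩ := exists_cls_eq X
  obtain ⟨Q', hQ', rfl⟩ := exists_cls_eq Y
  rw [latticeClass_cls, latticeClass_cls, Con.eq] at h
  exact (cls_eq_cls_iff hQ hQ').2 ((gammaEquiv_iff_homothety hD hN hQ hQ').2 h)

/-! ### Dirichlet composition -/

/-- The coefficients of a Dirichlet composition. -/
theorem IsDirichletComposition.exists_coeffs {Q Q' Q'' : BinForm}
    (h : IsDirichletComposition D Q Q' Q'') : Q''.a = Q.a * Q'.a ∧ Q''.disc = D ∧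
      ∃ k k' u v t : ℤ, Q.b = Q''.b + 2 * Q.a * k ∧ Q'.b = Q''.b + 2 * Q'.a * k' ∧
        u * Q.a + v * Q'.a + t * Q''.b = 1 := by
  obtain ⟨h1, h2, h3, h4, h5, h6⟩ := h
  obtain ⟨k, hk⟩ := h3.dvd
  obtain ⟨k', hk'⟩ := h4.dvd
  obtain ⟨u, v, t, huvt⟩ := exists_eq_one_of_gcd_gcd h1
  -- Modulo the ideal `(a, a')`, the half sum is `B`, which may replace it in the gcd condition.
  have hhalf : (Q.b + Q'.b) / 2 = Q''.b + Q.a * k + Q'.a * k' := by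
    have : Q.b + Q'.b = 2 * (Q''.b + Q.a * k + Q'.a * k') := by linear_combination hk + hk'
    rw [this, Int.mul_ediv_cancel_left _ two_ne_zero]
  refine ⟨h2, ?_, k, k', u + t * k, v + t * k', t, by linarith, by linarith, ?_⟩
  · have := Int.mul_ediv_cancel' h5.symm.dvd
    rw [← h6] at this
    rw [disc, h2]
    linear_combination -this
  · rw [hhalf] at huvt
    linear_combination huvt

/-- A prime dividing `a a'`, `B` and the last coefficient of `Q''` divides `a` or `a'`, hence all
coefficients of `Q` or all of `Q'`. -/
theorem IsDirichletComposition.mem_QFCoprime (hD : D < 0) {Q Q' Q'' : BinForm}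
    (hQ : Q ∈ QFCoprime D N) (hQ' : Q' ∈ QFCoprime D N)
    (h : IsDirichletComposition D Q Q' Q'') : Q'' ∈ QFCoprime D N := by
  obtain ⟨ha, hd, k, k', u, v, t, hk, hk', -⟩ := h.exists_coeffs
  have hQa := hQ.1.2.1.a_pos
  have hQa' := hQ'.1.2.1.a_pos
  have hp := isPrimitive_iff_forall_prime.1 hQ.1.1
  have hp' := isPrimitive_iff_forall_prime.1 hQ'.1.1
  have hc : Q.c = Q'.a * Q''.c + Q''.b * k + Q.a * k ^ 2 := by
    have := hQ.1.2.2.trans hd.symm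
    rw [disc, disc, hk, ha] at this
    refine mul_left_cancel₀ (mul_ne_zero four_ne_zero hQa.ne') ?_
    linear_combination -this
  have hc' : Q'.c = Q.a * Q''.c + Q''.b * k' + Q'.a * k' ^ 2 := by
    have := hQ'.1.2.2.trans hd.symm
    rw [disc, disc, hk', ha] at this
    refine mul_left_cancel₀ (mul_ne_zero four_ne_zero hQa'.ne') ?_
    linear_combination -this
  refine mem_QFCoprime_of_a_pos hD (isPrimitive_iff_forall_prime.2 fun p hpp h1 h2 h3 => ?_)
    (ha ▸ mul_pos hQa hQa') hd (ha ▸ (isCoprime_a hQ).mul_left (isCoprime_a hQ'))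
  rw [ha] at h1
  rcases (Nat.prime_iff_prime_int.1 hpp).dvd_or_dvd h1 with h1 | h1
  · refine hp p hpp h1 ?_ ?_
    · rw [hk]; exact dvd_add h2 ((h1.mul_left 2).mul_right k)
    · rw [hc]; exact dvd_add (dvd_add (h3.mul_left _) (h2.mul_right _)) (h1.mul_right _)
  · refine hp' p hpp h1 ?_ ?_
    · rw [hk']; exact dvd_add h2 ((h1.mul_left 2).mul_right k')
    · rw [hc']; exact dvd_add (dvd_add (h3.mul_left _) (h2.mul_right _)) (h1.mul_right _)

theorem IsDirichletComposition.latticeClass_eq (hD : D < 0) (hN : 0 < N) {Q Q' Q'' : BinForm}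
    (hQ : Q ∈ QFCoprime D N) (hQ' : Q' ∈ QFCoprime D N) (hQ'' : Q'' ∈ QFCoprime D N)
    (h : IsDirichletComposition D Q Q' Q'') : latticeClass hD hN (cls Q'' hQ'') =
      latticeClass hD hN (cls Q hQ) * latticeClass hD hN (cls Q' hQ') := by
  obtain ⟨ha, -, k, k', u, v, t, hk, hk', huvt⟩ := h.exists_coeffs
  obtain ⟨x, y, hxy⟩ := isCoprime_a hQ
  rw [latticeClass_cls, latticeClass_cls, latticeClass_cls, ← Con.coe_mul]
  -- After scaling, `B` becomes `N B`. Multiplying `t B` by `x a + y N = 1` restores the coprimality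
  -- relation.
  rw [lattice_mul_lattice (f'' := Q''.scale N) (k := N * k) (k' := N * k')
    (u := u + t * Q''.b * x) (v := v) (t := t * y)
    ((disc_scale_of_mem hQ).trans (disc_scale_of_mem hQ'').symm)
    ((disc_scale_of_mem hQ').trans (disc_scale_of_mem hQ'').symm) (disc_scale_neg hD hN hQ'')
    ha]
  · simp only [scale, hk]; ring
  · simp only [scale, hk']; ring
  · simp only [scale]; linear_combination huvt + t * Q''.b * hxy

theorem exists_isDirichletComposition {Q Q' : BinForm} (hQ : Q.disc = D) (hQ' : Q'.disc = D)
    (h : IsCoprime Q.a Q'.a) : ∃ Q'', IsDirichletComposition D Q Q' Q'' := by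
  obtain ⟨m, hm⟩ : ∃ m, Q'.b = Q.b + 2 * m := by
    have h4 : Q'.b ^ 2 - 4 * Q'.a * Q'.c = Q.b ^ 2 - 4 * Q.a * Q.c := hQ'.trans hQ.symm
    have : Even (Q'.b ^ 2 - Q.b ^ 2) := ⟨2 * (Q'.a * Q'.c - Q.a * Q.c), by linarith⟩
    rw [Int.even_sub, Int.even_pow' two_ne_zero, Int.even_pow' two_ne_zero, ← Int.even_sub] at this
    obtain ⟨m, hm⟩ := this
    exact ⟨m, by linarith⟩
  obtain ⟨u, v, huv⟩ := id h
  -- The Chinese remainder theorem in explicit form, from `u a + v a' = 1`.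
  have hB' : Q.b + 2 * Q.a * (u * m) = Q'.b - 2 * Q'.a * (v * m) := by
    linear_combination 2 * m * huv - hm
  set B := Q.b + 2 * Q.a * (u * m) with hB
  have hgcd : Int.gcd Q.a Q'.a = 1 := Int.isCoprime_iff_gcd_eq_one.1 h
  have hdvd : 4 * (Q.a * Q'.a) ∣ B ^ 2 - D := by
    have h1 : B ^ 2 - D = 4 * (Q.a * (Q.c + Q.b * (u * m) + Q.a * (u * m) ^ 2)) := by
      rw [← hQ, disc, hB]; ring
    have h2 : B ^ 2 - D = 4 * (Q'.a * (Q'.c - Q'.b * (v * m) + Q'.a * (v * m) ^ 2)) := by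
      rw [← hQ', disc, hB']; ring
    rw [h1]
    refine mul_dvd_mul_left 4 (h.mul_dvd (dvd_mul_right _ _) ?_)
    exact Dvd.intro _ (mul_left_cancel₀ four_ne_zero (h2.symm.trans h1))
  refine ⟨⟨Q.a * Q'.a, B, (B ^ 2 - D) / (4 * (Q.a * Q'.a))⟩, by simp [hgcd], rfl, ?_, ?_, ?_, rfl⟩
  · exact (Int.modEq_iff_dvd.2 ⟨u * m, by rw [hB]; ring⟩ : Q.b ≡ B [ZMOD _]).symm
  · exact Int.modEq_iff_dvd.2 ⟨v * m, by rw [hB']; ring⟩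
  · exact (Int.modEq_iff_dvd.2 hdvd).symm

/-- Any two classes have representatives which can be composed. -/
theorem exists_cls_isDirichletComposition (hD : D < 0) (hN : 0 < N) (X Y : FormClass D N) :
    ∃ (Q Q' Q'' : BinForm) (hQ : Q ∈ QFCoprime D N) (hQ' : Q' ∈ QFCoprime D N),
      cls Q hQ = X ∧ cls Q' hQ' = Y ∧ Int.gcd Q.a Q'.a = 1 ∧
        IsDirichletComposition D Q Q' Q'' := by
  obtain ⟨Q, hQ, rfl⟩ := exists_cls_eq X
  obtain ⟨Q₁, hQ₁, rfl⟩ := exists_cls_eq Y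
  obtain ⟨Q', hQ', h, hcop⟩ := exists_cls_eq_isCoprime hD hN hQ₁ hQ.1.2.1.a_pos.ne'
  obtain ⟨Q'', hQ''⟩ := exists_isDirichletComposition hQ.1.2.2 hQ'.1.2.2 hcop.symm
  exact ⟨Q, Q', Q'', hQ, hQ', rfl, h.symm, Int.isCoprime_iff_gcd_eq_one.1 hcop.symm, hQ''⟩

/-! ### Identity and inverses -/

/-- The principal form of discriminant `D`. -/
def principal (D : ℤ) : BinForm := ⟨1, D % 2, ((D % 2) ^ 2 - D) / 4⟩

theorem principal_of_zero (h : D ≡ 0 [ZMOD 4]) : principal D = ⟨1, 0, -(D / 4)⟩ := by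
  have h4 : D % 4 = 0 := h
  have h2 : D % 2 = 0 := by omega
  rw [principal, h2]
  congr 1
  omega

theorem principal_of_one (h : D ≡ 1 [ZMOD 4]) : principal D = ⟨1, 1, (1 - D) / 4⟩ := by
  have h4 : D % 4 = 1 := h
  have h2 : D % 2 = 1 := by omega
  rw [principal, h2, one_pow]

theorem principal_mem (N : ℕ) (hD : D < 0) (hD4 : D ≡ 0 [ZMOD 4] ∨ D ≡ 1 [ZMOD 4]) :
    principal D ∈ QFCoprime D N := by
  rcases hD4 with h | h
  · rw [principal_of_zero h]; exact principal_zero_mem N hD h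
  · rw [principal_of_one h]; exact principal_one_mem N hD h

theorem isDirichletComposition_principal {Q : BinForm} (hQ : Q.disc = D) (ha : Q.a ≠ 0) :
    IsDirichletComposition D (principal D) Q Q := by
  have hdisc : Q.b ^ 2 - D = 4 * (1 * Q.a) * Q.c := by rw [← hQ, disc]; ring
  have hb : Q.b % 2 = D % 2 := by
    have h1 : (Q.b ^ 2 - D) % 2 = 0 :=
      Int.emod_eq_zero_of_dvd ⟨2 * (1 * Q.a) * Q.c, by rw [hdisc]; ring⟩
    have h2 : Q.b ^ 2 % 2 = Q.b % 2 := by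
      rcases Int.emod_two_eq_zero_or_one Q.b with h | h <;> simp [pow_two, Int.mul_emod, h]
    omega
  refine ⟨by simp [principal], by simp [principal], ?_, rfl, ?_, ?_⟩
  · have : (D % 2) ≡ Q.b [ZMOD 2] := by rw [← hb]; exact Int.mod_modEq _ _
    exact this.symm
  · exact (Int.modEq_iff_dvd.2 ⟨Q.c, hdisc⟩).symm
  · change Q.c = (Q.b ^ 2 - D) / (4 * (1 * Q.a))
    rw [hdisc, Int.mul_ediv_cancel_left]
    simpa using ha

theorem latticeClass_mul_opposite (hD : D < 0) (hN : 0 < N)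
    (hD4 : D ≡ 0 [ZMOD 4] ∨ D ≡ 1 [ZMOD 4]) {Q : BinForm} (hQ : Q ∈ QFCoprime D N) :
    latticeClass hD hN (cls Q hQ) * latticeClass hD hN (cls Q.opposite (opposite_mem hQ)) =
      latticeClass hD hN (cls (principal D) (principal_mem N hD hD4)) := by
  have hop : Q.opposite.scale N = (Q.scale N).opposite := by simp [scale, opposite]
  rw [latticeClass_cls, latticeClass_cls, latticeClass_cls, ← Con.coe_mul, hop, eq_comm, Con.eq]
  obtain ⟨u, v, t, h⟩ := exists_eq_one_of_gcd_gcd (hQ.1.1.scale (isCoprime_a hQ))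
  exact homothety_mul_opposite hQ.1.2.1.a_pos.ne' (disc_scale_neg hD hN hQ)
    ((disc_scale_of_mem (principal_mem N hD hD4)).trans (disc_scale_of_mem hQ).symm) rfl h

end Classes

end BinForm

/-! ### The group structure -/

theorem mainTheorem11 (D : ℤ) (hD : D < 0) (hD4 : D ≡ 0 [ZMOD 4] ∨ D ≡ 1 [ZMOD 4])
    (N : ℕ) (hN : 0 < N) :
    ∃ _G : CommGroup (BinForm.FormClass D N),
      -- multiplication is given by Dirichlet composition, for all composable representatives
      (∀ (Q Q' Q'' : BinForm) (hQ : Q ∈ BinForm.QFCoprime D N)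
        (hQ' : Q' ∈ BinForm.QFCoprime D N),
        BinForm.IsDirichletComposition D Q Q' Q'' →
          ∃ hQ'' : Q'' ∈ BinForm.QFCoprime D N,
            BinForm.cls Q hQ * BinForm.cls Q' hQ' = BinForm.cls Q'' hQ'') ∧
      -- and it is the only operation given by composition of coprime representatives
      (∀ op : BinForm.FormClass D N → BinForm.FormClass D N → BinForm.FormClass D N,
        BinForm.IsCompositionLaw op → ∀ X Y, op X Y = X * Y) ∧
      -- the identity element
      (∀ h : D ≡ 0 [ZMOD 4],
        (1 : BinForm.FormClass D N) =
          BinForm.cls ⟨1, 0, -(D / 4)⟩ (BinForm.principal_zero_mem N hD h)) ∧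
      (∀ h : D ≡ 1 [ZMOD 4],
        (1 : BinForm.FormClass D N) =
          BinForm.cls ⟨1, 1, (1 - D) / 4⟩ (BinForm.principal_one_mem N hD h)) ∧
      -- inverses
      (∀ (Q : BinForm) (hQ : Q ∈ BinForm.QFCoprime D N),
        (BinForm.cls Q hQ)⁻¹ = BinForm.cls Q.opposite (BinForm.opposite_mem hQ)) := by
  let M := BinForm.homothety.Quotient
  let Ψ : BinForm.FormClass D N → M := BinForm.latticeClass (D := D) hD hN
  have hΨ : Function.Injective Ψ := BinForm.latticeClass_injective hD hN
  have hmul : ∀ X Y : BinForm.FormClass D N, ∃ Z, Ψ Z = Ψ X * Ψ Y := by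
    intro X Y
    obtain ⟨Q, Q', Q'', hQ, hQ', rfl, rfl, -, h⟩ :=
      BinForm.exists_cls_isDirichletComposition hD hN X Y
    exact ⟨_, h.latticeClass_eq hD hN hQ hQ' (h.mem_QFCoprime hD hQ hQ')⟩
  let E : BinForm.FormClass D N :=
    BinForm.cls (BinForm.principal D) (BinForm.principal_mem N hD hD4)
  -- `Ψ E` is not the unit of the monoid, which is the class of `ℤ`; it need only act as identity on
  -- the image.
  have hE : ∀ X, Ψ E * Ψ X = Ψ X := by
    intro X
    obtain ⟨Q, hQ, rfl⟩ := BinForm.exists_cls_eq X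
    exact ((BinForm.isDirichletComposition_principal hQ.1.2.2 hQ.1.2.1.a_pos.ne').latticeClass_eq
      hD hN (BinForm.principal_mem N hD hD4) hQ hQ).symm
  have hinv : ∀ X, ∃ Y, Ψ X * Ψ Y = Ψ E := by
    intro X
    obtain ⟨Q, hQ, rfl⟩ := BinForm.exists_cls_eq X
    exact ⟨_, BinForm.latticeClass_mul_opposite hD hN hD4 hQ⟩
  -- Injectivity of `Ψ` makes the chosen product unique and transfers each group law from the
  -- monoid.
  choose mul hmul using hmul
  choose inv hinv using hinv
  let G : CommGroup (BinForm.FormClass D N) :=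
    { mul := mul
      one := E
      inv := inv
      mul_assoc := fun X Y Z => hΨ <| by
        change Ψ (mul (mul X Y) Z) = Ψ (mul X (mul Y Z))
        simp only [hmul]; exact mul_assoc (G := M) _ _ _
      one_mul := fun X => hΨ <| (hmul E X).trans (hE X)
      mul_one := fun X => hΨ <| (hmul X E).trans ((mul_comm (G := M) _ _).trans (hE X))
      inv_mul_cancel := fun X => hΨ <| (hmul _ X).trans ((mul_comm (G := M) _ _).trans (hinv X))
      mul_comm := fun X Y => hΨ <| (hmul X Y).trans ((mul_comm (G := M) _ _).trans (hmul Y X).symm) }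
  have hcomp : ∀ (Q Q' Q'' : BinForm) (hQ : Q ∈ BinForm.QFCoprime D N)
      (hQ' : Q' ∈ BinForm.QFCoprime D N), BinForm.IsDirichletComposition D Q Q' Q'' →
        ∃ hQ'' : Q'' ∈ BinForm.QFCoprime D N,
          BinForm.cls Q hQ * BinForm.cls Q' hQ' = BinForm.cls Q'' hQ'' := by
    intro Q Q' Q'' hQ hQ' h
    have hQ'' := h.mem_QFCoprime hD hQ hQ'
    exact ⟨hQ'', hΨ ((hmul _ _).trans (h.latticeClass_eq hD hN hQ hQ' hQ'').symm)⟩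
  refine ⟨G, hcomp, ?_, ?_, ?_, ?_⟩
  · intro op hop X Y
    obtain ⟨Q, Q', Q'', hQ, hQ', rfl, rfl, hgcd, h⟩ :=
      BinForm.exists_cls_isDirichletComposition hD hN X Y
    obtain ⟨hQ'', heq⟩ := hcomp Q Q' Q'' hQ hQ' h
    rw [hop Q Q' Q'' hQ hQ' hQ'' hgcd h, heq]
  · intro h
    change E = _
    simp only [E, BinForm.principal_of_zero h]
  · intro h
    change E = _
    simp only [E, BinForm.principal_of_one h]
  · intro Q hQ
    refine inv_eq_of_mul_eq_one_right (hΨ ?_)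
    exact (hmul _ _).trans (BinForm.latticeClass_mul_opposite hD hN hD4 hQ)
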